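/- Let $\mathcal{A}$ be a Grothendieck category and let $\mathcal{B}\subseteq\mathcal{A}$ be a Serre subcategory (a full subcategory containing $0$ and closed under subobjects, quotient objects and extensions). Assume that $\mathcal{B}$ is localizing, i.e. the inclusion $\mathcal{B}\hookrightarrow\mathcal{A}$ has a right adjoint $\tau:\mathcal{A}\to\mathcal{B}$ (the torsion functor), and that $\mathcal{B}$ is closed under essential monomorphisms: if $i:X\to Y$ is an essential monomorphism (a monomorphism such that every $g:Y\to Z$ with $g\circ i$ mono is itself mono) and $X\in\mathcal{B}$, then $Y\in\mathcal{B}$. Call an abelian category $\mathcal{C}$ *Gorenstein* if: - (G1) $\mathcal{C}$ has arbitrary set-indexed coproducts and these are exact, $\mathcal{C}$ has enough injective objects, and $\mathcal{C}$ has a generator of finite projective dimension (an object $T$ is a generator if $\mathrm{Hom}_{\mathcal{C}}(T,-)$ is faithful); - (G2) an object of $\mathcal{C}$ has finite projective dimension if and only if it has finite injective dimension; - (G3) there is an integer $d\ge 0$ such that every injective object of $\mathcal{C}$ has projective dimension at most $d$. Here the projective and injective dimensions are defined by the vanishing of $\mathrm{Ext}^n_{\mathcal{C}}(X,-)$, respectively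 $\mathrm{Ext}^n_{\mathcal{C}}(-,X)$, for large $n$. Suppose that $\mathcal{A}$ is Gorenstein and that $\tau$ has finite cohomological dimension, i.e. there is an integer $d$ such that the right derived functors $R^n\tau$ vanish for all $n\ge d$. Then the quotient category $\mathcal{A}/\mathcal{B}$ (the localization of $\mathcal{A}$ at the morphisms whose kernel and cokernel both lie in $\mathcal{B}$) is Gorenstein. -/

import Mathlib

open CategoryTheory CategoryTheory.Limits

universe w v u

noncomputable section

/-- A monomorphism `i : X ⟶ Y` is essential if every `g : Y ⟶ Z` for which the composite
`X ⟶ Y ⟶ Z` is a monomorphism is itself a monomorphism. -/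
structure IsEssentialMono {C : Type u} [Category.{v} C] {X Y : C} (i : X ⟶ Y) : Prop where
  mono : Mono i
  mono_of_comp : ∀ ⦃Z : C⦄ (g : Y ⟶ Z), Mono (i ≫ g) → Mono g

/-- The full subcategory of objects satisfying `P` is closed under essential monomorphisms. -/
def IsClosedUnderEssentialMonos {C : Type u} [Category.{v} C] (P : ObjectProperty C) : Prop :=
  ∀ ⦃X Y : C⦄ (i : X ⟶ Y), IsEssentialMono i → P X → P Y

/-- A full subcategory is localizing if its inclusion functor admits a right adjoint.
(It is used for Serre subcategories of abelian categories.) -/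
class IsLocalizing {C : Type u} [Category.{v} C] (P : ObjectProperty C) : Prop where
  isLeftAdjoint_ι : P.ι.IsLeftAdjoint

attribute [instance] IsLocalizing.isLeftAdjoint_ι

/-- A Serre subcategory is closed under finite products; hence it is itself an abelian category. -/
instance {C : Type u} [Category.{v} C] [Abelian C] (P : ObjectProperty C) [P.IsSerreClass] :
    P.IsClosedUnderFiniteProducts := by
  have : P.IsClosedUnderBinaryProducts := ⟨by
    rintro X ⟨p⟩
    let e : X ≅ p.diag.obj ⟨.left⟩ ⊞ p.diag.obj ⟨.right⟩ :=
      p.isLimit.conePointsIsoOfNatIso (BinaryBiproduct.isLimit _ _) (mapPairIso (Iso.refl _) (Iso.refl _))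
    exact P.prop_of_iso e.symm (P.prop_biprod (p.prop_diag_obj _) (p.prop_diag_obj _))⟩
  exact .mk'

/-- The torsion functor: the right adjoint of the inclusion of a localizing subcategory. -/
def torsionFunctor {C : Type u} [Category.{v} C] (P : ObjectProperty C) [IsLocalizing P] :
    C ⥤ P.FullSubcategory :=
  P.ι.rightAdjoint

instance {C : Type u} [Category.{v} C] [Abelian C] (P : ObjectProperty C) [P.IsSerreClass]
    [IsLocalizing P] : (torsionFunctor P).Additive :=
  (Adjunction.ofIsLeftAdjoint P.ι).right_adjoint_additive

/-- An additive functor `F` has finite cohomological dimension if its right derived functors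
`Rⁿ F` vanish for all large `n`. -/
def HasFiniteCohomologicalDimension {C : Type*} [Category* C] [Abelian C]
    [HasInjectiveResolutions C] {D : Type*} [Category* D] [Abelian D] (F : C ⥤ D)
    [F.Additive] : Prop :=
  ∃ d : ℕ, ∀ n : ℕ, d ≤ n → IsZero (F.rightDerived n)

/-- The quotient of an abelian category by a Serre subcategory: the localization at the
morphisms whose kernel and cokernel lie in the subcategory. -/
abbrev SerreQuotient {C : Type u} [Category.{v} C] [Abelian C] (P : ObjectProperty C)
    [P.IsSerreClass] : Type u :=
  P.isoModSerre.Localization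

/-- The abelian structure on the quotient category. -/
instance {C : Type u} [Category.{v} C] [Abelian C] (P : ObjectProperty C)
    [P.IsSerreClass] : Abelian (SerreQuotient P) :=
  ObjectProperty.SerreClassLocalization.abelian P.isoModSerre.Q P

/-- Gorenstein (abelian) categories. The universe `w` is the one in which the index sets of
coproducts live. The dimensions take values in `WithBot ℕ∞` (with `⊥` for zero objects), so
`< ⊤` means finite. -/
class IsGorensteinCategory (C : Type u) [Category.{v} C] [Abelian C] : Prop where
  hasCoproducts : HasCoproducts.{w} C
  ab4 : AB4OfSize.{w} C
  enoughInjectives : EnoughInjectives C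
  exists_generator : ∃ T : C, IsSeparator T ∧ projectiveDimension T < ⊤
  finite_iff : ∀ X : C, projectiveDimension X < ⊤ ↔ injectiveDimension X < ⊤
  bounded : ∃ d : ℕ, ∀ I : C, Injective I → projectiveDimension I ≤ d

end

/-! Closure under essential monos makes the torsion part τE of an injective E a direct summand, so
E/τE is injective and torsion-free, hence local. This gives every object a local reflection. So the
exact localization functor L has a fully faithful right adjoint G, and L preserves injectives
(`injective_localization_obj`). Coproducts, AB4, enough injectives and the generator LT are
transported along L ⊣ G.

The core is that L raises projective dimension by a bounded amount
(`exists_hasProjectiveDimensionLT_localization_obj`). Beyond the cohomological dimension of τ,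
dividing the cosyzygies of an injective resolution by torsion leaves short exact sequences with
torsion-free injective middle terms. Along these, vanishing of Ext passes to the quotient category,
and finitely many dimension shifts reach an arbitrary object. Since G preserves injectives and LG ≅
1, (G3) follows, and (G3) gives one half of (G2). For the other half, copowers of T have uniformly
bounded injective dimension, their images under L cover every object, and this bounds the injective
dimension of all objects of finite projective dimension. -/

namespace CategoryTheory

open Abelian

/-! ### Projective and injective dimension, and dimension shifting. -/

section HomologicalDimension

variable {C : Type u} [Category.{v} C] [Abelian C]

lemma projectiveDimension_lt_top_iff {X : C} :
    projectiveDimension X < ⊤ ↔ ∃ n, HasProjectiveDimensionLT X n := by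
  rw [lt_top_iff_ne_top, projectiveDimension_ne_top_iff]
  exact ⟨fun ⟨n, h⟩ ↦ ⟨_, h⟩, fun ⟨n, _⟩ ↦ ⟨n, hasProjectiveDimensionLT_of_ge X n _ n.le_succ⟩⟩

lemma injectiveDimension_lt_top_iff {X : C} :
    injectiveDimension X < ⊤ ↔ ∃ n, HasInjectiveDimensionLT X n := by
  rw [lt_top_iff_ne_top, injectiveDimension_ne_top_iff]
  exact ⟨fun ⟨n, h⟩ ↦ ⟨_, h⟩, fun ⟨n, _⟩ ↦ ⟨n, hasInjectiveDimensionLT_of_ge X n _ n.le_succ⟩⟩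

/-- The short exact sequence given by an embedding into an injective object. -/
lemma exists_shortExact_injective [EnoughInjectives C] (Y : C) :
    ∃ S : ShortComplex C, S.ShortExact ∧ Injective S.X₂ ∧ S.X₁ = Y := by
  obtain ⟨p⟩ := EnoughInjectives.presentation Y
  exact ⟨ShortComplex.mk _ _ (cokernel.condition p.f),
    { exact := ShortComplex.exact_cokernel p.f }, p.injective, rfl⟩

lemma Abelian.Ext.subsingleton_of_iso [HasExt.{w} C] {X X' Y Y' : C} (e : X ≅ X') (f : Y ≅ Y')
    {n : ℕ} (h : Subsingleton (Ext X Y n)) : Subsingleton (Ext X' Y' n) := by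
  refine ⟨fun a b ↦ ?_⟩
  have key (a : Ext X' Y' n) :
      a = (mk₀ e.inv).comp (((mk₀ e.hom).comp a (zero_add n)).comp (mk₀ f.inv) (add_zero n)
        |>.comp (mk₀ f.hom) (add_zero n)) (zero_add n) := by
    simp [Ext.comp_assoc_of_third_deg_zero]
  rw [key a, key b]
  congr 2
  exact Subsingleton.elim _ _

namespace ShortComplex.ShortExact

variable [HasExt.{w} C] {S : ShortComplex C} (hS : S.ShortExact)

include hS

/-- Dimension shifting along a short exact sequence with injective middle term. -/
lemma subsingleton_ext_succ_iff (_ : Injective S.X₂) (X : C) (n : ℕ) :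
    Subsingleton (Ext X S.X₁ (n + 2)) ↔ Subsingleton (Ext X S.X₃ (n + 1)) := by
  constructor
  · refine fun h ↦ subsingleton_of_forall_eq 0 fun x ↦ ?_
    obtain ⟨y, rfl⟩ := Ext.covariant_sequence_exact₃ X hS x rfl (Subsingleton.elim _ _)
    rw [y.eq_zero_of_injective, Ext.zero_comp]
  · refine fun h ↦ subsingleton_of_forall_eq 0 fun x ↦ ?_
    obtain ⟨y, rfl⟩ := Ext.covariant_sequence_exact₁ X hS x (Ext.eq_zero_of_injective _) rfl
    rw [Subsingleton.elim y 0, Ext.zero_comp]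

lemma subsingleton_ext_one_iff (_ : Injective S.X₂) (X : C) :
    Subsingleton (Ext X S.X₁ 1) ↔ ∀ f : X ⟶ S.X₃, ∃ g : X ⟶ S.X₂, g ≫ S.g = f := by
  constructor
  · intro h f
    obtain ⟨y, hy⟩ := Ext.covariant_sequence_exact₃ X hS (Ext.mk₀ f) rfl (Subsingleton.elim _ _)
    obtain ⟨g, rfl⟩ := Ext.homEquiv₀.symm.surjective y
    exact ⟨g, Ext.homEquiv₀.symm.injective (by simpa using hy)⟩
  · refine fun h ↦ subsingleton_of_forall_eq 0 fun x ↦ ?_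
    obtain ⟨y, rfl⟩ := Ext.covariant_sequence_exact₁ X hS x (Ext.eq_zero_of_injective _) rfl
    obtain ⟨f, rfl⟩ := Ext.homEquiv₀.symm.surjective y
    obtain ⟨g, rfl⟩ := h f
    simp [← Ext.mk₀_comp_mk₀]

end ShortComplex.ShortExact

/-- Shifting in the second variable reduces to degree one, where vanishing means lifting maps along
I ⟶ I/Y; such lifts glue over a coproduct. Exactness of coproducts plays no role. -/
lemma Limits.subsingleton_ext_of_isColimit [EnoughInjectives C] [HasExt.{w} C] {ι : Type*}
    {X : ι → C} {c : Cofan X} (hc : IsColimit c) (n : ℕ) :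
    ∀ (Y : C), (∀ i, Subsingleton (Ext (X i) Y (n + 1))) → Subsingleton (Ext c.pt Y (n + 1)) := by
  induction n with
  | zero =>
    intro Y h
    obtain ⟨S, hS, hI, rfl⟩ := exists_shortExact_injective Y
    simp only [zero_add, hS.subsingleton_ext_one_iff hI] at h ⊢
    intro f
    choose g hg using fun i ↦ h i (c.inj i ≫ f)
    exact ⟨Cofan.IsColimit.desc hc g, Cofan.IsColimit.hom_ext hc _ _ (by simp [hg])⟩
  | succ n hn =>
    intro Y h
    obtain ⟨S, hS, hI, rfl⟩ := exists_shortExact_injective Y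
    simp only [add_assoc, one_add_one_eq_two, hS.subsingleton_ext_succ_iff hI] at h ⊢
    exact hn _ h

lemma Limits.hasProjectiveDimensionLT_of_isColimit [EnoughInjectives C] {ι : Type*}
    {X : ι → C} {c : Cofan X} (hc : IsColimit c) (n : ℕ)
    (h : ∀ i, HasProjectiveDimensionLT (X i) (n + 1)) : HasProjectiveDimensionLT c.pt (n + 1) := by
  let := HasExt.standard C
  exact hasProjectiveDimensionLT_of_enoughInjectives _ _ fun Y ↦
    subsingleton_ext_of_isColimit hc n Y
      fun i ↦ HasProjectiveDimensionLT.subsingleton (X i) (n + 1) _ le_rfl Y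

open Classical in
/-- In a category with zero morphisms, each summand is a retract of a coproduct. -/
noncomputable def Limits.Sigma.retract {ι : Type*} (X : ι → C) [HasCoproduct X] (i : ι) :
    Retract (X i) (∐ X) where
  i := Sigma.ι X i
  r := Sigma.desc fun j ↦ if h : j = i then eqToHom (by rw [h]) else 0

/-- If finite projective dimension implies finite injective dimension, then the copowers of an
object of finite projective dimension have uniformly bounded injective dimension. -/
lemma exists_hasInjectiveDimensionLT_copower [EnoughInjectives C] [HasCoproducts.{w} C]
    (h : ∀ X : C, projectiveDimension X < ⊤ → injectiveDimension X < ⊤)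
    {T : C} (hT : projectiveDimension T < ⊤) :
    ∃ e : ℕ, ∀ ι : Type w, HasInjectiveDimensionLT (∐ fun _ : ι ↦ T) e := by
  obtain ⟨n, hn⟩ := projectiveDimension_lt_top_iff.1 hT
  have hι (ι : Type w) : HasProjectiveDimensionLT (∐ fun _ : ι ↦ T) (n + 1) :=
    hasProjectiveDimensionLT_of_isColimit (coproductIsCoproduct _) n fun _ ↦
      hasProjectiveDimensionLT_of_ge T n _ n.le_succ
  by_contra! H
  choose J hJ using H
  -- If for each k some copower violates the bound k, their coproduct still has finite projective
  -- dimension, hence some finite injective dimension m, which its m-th summand inherits.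
  let Z := ∐ fun k : ULift.{w} ℕ ↦ (∐ fun _ : J k.down ↦ T)
  have : HasProjectiveDimensionLT Z (n + 1) :=
    hasProjectiveDimensionLT_of_isColimit (coproductIsCoproduct _) n fun _ ↦ hι _
  obtain ⟨m, hm⟩ := injectiveDimension_lt_top_iff.1
    (h Z (projectiveDimension_lt_top_iff.2 ⟨_, this⟩))
  exact hJ m ((Sigma.retract (fun k : ULift.{w} ℕ ↦ ∐ fun _ : J k.down ↦ T)
    ⟨m⟩).hasInjectiveDimensionLT m)

/-- Induction along 0 → X → I → X' → 0: the bound does not grow, because a kernel of I ⟶ X' needs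
only dimension `< d + 2` of X'. -/
lemma hasProjectiveDimensionLT_of_hasInjectiveDimensionLT [EnoughInjectives C] {d : ℕ}
    (hd : ∀ I : C, Injective I → HasProjectiveDimensionLT I (d + 1)) (n : ℕ) :
    ∀ (X : C), HasInjectiveDimensionLT X n → HasProjectiveDimensionLT X (d + 1) := by
  induction n with
  | zero =>
    intro X hX
    have := (isZero_of_hasInjectiveDimensionLT_zero X).hasProjectiveDimensionLT_zero
    exact hasProjectiveDimensionLT_of_ge X 0 _ (by simp)
  | succ n hn =>
    intro X hX
    obtain ⟨S, hS, _, rfl⟩ := exists_shortExact_injective X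
    cases n with
    | zero =>
      have : Injective S.X₁ := inferInstance
      exact hd _ this
    | succ n =>
      have h₃ := hn _ ((hS.hasInjectiveDimensionLT_X₃_iff n ‹_›).2 hX)
      exact hS.hasProjectiveDimensionLT_X₁ (d + 1) (hd _ ‹_›)
        (hasProjectiveDimensionLT_of_ge S.X₃ (d + 1) _ (by lia))

/-- If every object is a quotient of an object of injective dimension `< e`, then every object
of finite projective dimension has injective dimension `< e`. -/
lemma hasInjectiveDimensionLT_of_hasProjectiveDimensionLT {e : ℕ}
    (he : ∀ X : C, ∃ (P : C) (p : P ⟶ X), Epi p ∧ HasInjectiveDimensionLT P e)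
    (X : C) (m : ℕ) [HasProjectiveDimensionLT X m] : HasInjectiveDimensionLT X e := by
  let := HasExt.standard C
  -- ξ splices k short exact sequences with middle terms of injective dimension `< e`, so
  -- multiplication by ξ is injective on Ext in degrees ≥ e. For k = m, ξ itself vanishes.
  have key (k : ℕ) : ∃ (K : C) (ξ : Ext X K k), ∀ (n : ℕ) (_ : e ≤ n) (Y : C) (y : Ext Y X n),
      y.comp ξ rfl = 0 → y = 0 := by
    induction k with
    | zero => exact ⟨X, Ext.mk₀ (𝟙 X), fun n _ Y y hy ↦ by simpa using hy⟩
    | succ k hk =>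
      obtain ⟨K, ξ, hξ⟩ := hk
      obtain ⟨P, p, _, _⟩ := he K
      have hS : (ShortComplex.mk _ _ (kernel.condition p)).ShortExact :=
        { exact := ShortComplex.exact_kernel p }
      refine ⟨kernel p, ξ.comp hS.extClass rfl, fun n hn Y y hy ↦ hξ n hn Y y ?_⟩
      rw [← Ext.comp_assoc (a₁₂ := n + k) (a₂₃ := k + 1) (a := n + k + 1) _ _ _ rfl rfl (by lia)] at hy
      obtain ⟨z, hz⟩ := Ext.covariant_sequence_exact₃ Y hS (y.comp ξ rfl) (by lia) hy
      rw [← hz, z.eq_zero_of_hasInjectiveDimensionLT e (by lia), Ext.zero_comp]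
  obtain ⟨K, ξ, hξ⟩ := key m
  refine HasInjectiveDimensionLT.mk fun n hn Y y ↦ hξ n hn Y y ?_
  rw [ξ.eq_zero_of_hasProjectiveDimensionLT m le_rfl, Ext.comp_zero]

lemma Functor.hasInjectiveDimensionLT_obj [EnoughInjectives C] {D : Type*} [Category* D]
    [Abelian D] (F : C ⥤ D) [F.Additive] [PreservesFiniteLimits F] [PreservesFiniteColimits F]
    (hF : ∀ I : C, Injective I → Injective (F.obj I)) (n : ℕ) :
    ∀ (X : C), HasInjectiveDimensionLT X n → HasInjectiveDimensionLT (F.obj X) n := by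
  induction n with
  | zero =>
    intro X hX
    exact (F.map_isZero (isZero_of_hasInjectiveDimensionLT_zero X)).hasInjectiveDimensionLT_zero
  | succ n hn =>
    intro X hX
    obtain ⟨S, hS, _, rfl⟩ := exists_shortExact_injective X
    cases n with
    | zero =>
      have : Injective S.X₁ := inferInstance
      have := hF _ this
      infer_instance
    | succ n =>
      have h₃ := hn _ ((hS.hasInjectiveDimensionLT_X₃_iff n ‹_›).2 hX)
      exact ((hS.map_of_exact F).hasInjectiveDimensionLT_X₃_iff n (hF _ ‹_›)).1 h₃

end HomologicalDimension

end CategoryTheory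

namespace CategoryTheory

/-! ### Essential subobjects via Zorn's lemma. -/

section Essential

variable {C : Type u} [Category.{v} C] [Abelian C] [IsGrothendieckAbelian.{w} C]

omit [Abelian C] [IsGrothendieckAbelian.{w} C] in
lemma Subobject.mk_factors_iff_exists {X Y Z : C} {f : X ⟶ Y} [Mono f] {g : Z ⟶ Y} :
    (Subobject.mk f).Factors g ↔ ∃ a : Z ⟶ X, a ≫ f = g :=
  Subobject.mk_factors_iff f g

/-- A directed union of subobjects meeting a given subobject trivially also meets it trivially. -/
lemma Subobject.exists_upperBound_of_isChain_disjoint {T E : C} (i : T ⟶ E) [Mono i]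
    (c : Set (Subobject E)) (hc : IsChain (· ≤ ·) c) (hc' : c.Nonempty)
    (h : ∀ U ∈ c, ∀ ⦃Z : C⦄ (z : Z ⟶ T), U.Factors (z ≫ i) → z = 0) :
    ∃ V : Subobject E, (∀ U ∈ c, U ≤ V) ∧
      ∀ ⦃Z : C⦄ (z : Z ⟶ T), V.Factors (z ≫ i) → z = 0 := by
  have : Small.{w} c := small_subset (Set.subset_univ c)
  obtain ⟨J, ⟨e⟩⟩ := this.equiv_small
  let s (j : J) : Subobject E := (e.symm j).1
  let : Preorder J := Preorder.lift s
  have : Nonempty J := ⟨e ⟨_, hc'.some_mem⟩⟩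
  have : IsDirected J (· ≤ ·) := ⟨fun a b ↦ by
    rcases hc.total (e.symm a).2 (e.symm b).2 with h | h
    · exact ⟨b, h, le_refl b⟩
    · exact ⟨a, le_refl a, h⟩⟩
  let F₀ : J ⥤ Subobject E := Monotone.functor (f := s) (fun _ _ h ↦ h)
  let F : J ⥤ MonoOver E := F₀ ⋙ Subobject.representative
  let G := F ⋙ MonoOver.forget _ ⋙ Over.forget _
  let f : colimit G ⟶ E := colimit.desc G (Cocone.mk E
    { app j := (F.obj j).obj.hom
      naturality {j j'} g := by simp [G, MonoOver.forget] })
  have hf (j : J) : colimit.ι G j ≫ f = (s j).arrow := by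
    simp [f]; rfl
  have : Mono f := IsGrothendieckAbelian.mono_of_isColimit_monoOver F (colimit.isColimit G) f hf
  refine ⟨Subobject.mk f, fun U hU ↦ ?_, fun Z z hz ↦ ?_⟩
  · obtain ⟨j, rfl⟩ : ∃ j, s j = U := ⟨e ⟨U, hU⟩, by simp [s]⟩
    exact Subobject.le_mk_of_comm (colimit.ι G j) (hf j)
  · obtain ⟨g, hg⟩ := Subobject.mk_factors_iff_exists.1 hz
    have := IsFiltered.isConnected J
    -- By AB5 a map into the union can be tested on its pullbacks to the members of the chain, where
    -- disjointness applies.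
    have : g ≫ f = 0 := IsColimit.pullback_zero_ext (colimit.isColimit G) fun j ↦ by
      have h0 : pullback.snd ((colimit.cocone G).ι.app j) g ≫ z = 0 := by
        refine h (s j) (e.symm j).2 _ ?_
        refine (Subobject.factors_iff _ _).2
          ⟨pullback.fst ((colimit.cocone G).ι.app j) g, ?_⟩
        have := pullback.condition (f := (colimit.cocone G).ι.app j) (g := g)
        rw [Category.assoc, ← hg, ← reassoc_of% this]
        exact congr_arg _ (hf j).symm
      rw [hg, reassoc_of% h0, zero_comp]
    rw [← cancel_mono i, ← hg, this, zero_comp]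

/-- Every subobject of an object becomes an essential subobject of some quotient. -/
lemma exists_epi_isEssentialMono {T E : C} (i : T ⟶ E) [Mono i] :
    ∃ (Q : C) (p : E ⟶ Q), Epi p ∧ IsEssentialMono (i ≫ p) := by
  let S : Set (Subobject E) := {U | ∀ ⦃Z : C⦄ (z : Z ⟶ T), U.Factors (z ≫ i) → z = 0}
  have hbot : ⊥ ∈ S := fun Z z hz ↦ by
    rw [Subobject.bot_factors_iff_zero] at hz
    rwa [← cancel_mono i, zero_comp]
  -- U is maximal among subobjects with U ∩ T = 0, and the quotient is E/U.
  obtain ⟨U, -, hU⟩ := zorn_le_nonempty₀ S (fun c hcS hc y hy ↦ by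
    obtain ⟨V, h₁, h₂⟩ := Subobject.exists_upperBound_of_isChain_disjoint i c hc ⟨y, hy⟩
      (fun U hU ↦ hcS hU)
    exact ⟨V, h₂, h₁⟩) ⊥ hbot
  let p := cokernel.π U.arrow
  have hp {Z : C} (z : Z ⟶ E) (hz : z ≫ p = 0) : U.Factors z :=
    (Subobject.factors_iff _ _).2 ⟨(Abelian.monoLift U.arrow z hz : Z ⟶ (U : C)), Abelian.monoLift_comp U.arrow z hz⟩
  refine ⟨_, p, inferInstance, ?_, fun Z g hg ↦ ?_⟩
  · refine Preadditive.mono_of_cancel_zero _ fun z hz ↦ hU.1 z (hp _ (by simpa using hz))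
  -- K contains U and still meets T trivially, so K = U by maximality and g has zero kernel.
  · let K := Subobject.mk (kernel.ι (p ≫ g))
    have hUK : U ≤ K := Subobject.le_mk_of_comm (kernel.lift _ U.arrow (by simp [p])) (by simp)
    have hK : K ∈ S := fun W z hz ↦ by
      obtain ⟨a, ha⟩ := Subobject.mk_factors_iff_exists.1 hz
      rw [← cancel_mono ((i ≫ p) ≫ g), zero_comp, Category.assoc,
        ← reassoc_of% ha, kernel.condition, comp_zero]
    have hKU : K ≤ U := hU.2 hK hUK
    refine Preadditive.mono_of_cancel_zero _ fun {W} x hx ↦ ?_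
    rw [← cancel_epi (pullback.snd p x), comp_zero, ← pullback.condition]
    have h₁ : K.Factors (pullback.fst p x) := Subobject.mk_factors_iff_exists.2
      ⟨kernel.lift _ (pullback.fst p x) (by rw [pullback.condition_assoc, hx, comp_zero]),
        kernel.lift_ι _ _ _⟩
    rw [← U.factorThru_arrow _ (Subobject.factors_of_le _ hKU h₁), Category.assoc,
      cokernel.condition, comp_zero]

end Essential

/-! ### Torsion parts and torsion-free quotients. -/

section Torsion

variable {C : Type u} [Category.{v} C] (P : ObjectProperty C)

/-- An object is torsion-free if it receives no nonzero morphism from an object of `P`. -/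
def ObjectProperty.IsTorsionFree [Abelian C] (X : C) : Prop :=
  ∀ ⦃T : C⦄ (f : T ⟶ X), P T → f = 0

variable {P} in
lemma ObjectProperty.IsTorsionFree.of_mono [Abelian C] {X Y : C} (hY : P.IsTorsionFree Y) (f : X ⟶ Y)
    [Mono f] : P.IsTorsionFree X := fun T g hT ↦ by
  rw [← cancel_mono f, hY (g ≫ f) hT, zero_comp]

variable {P} in
lemma ObjectProperty.IsTorsionFree.factors [Abelian C] {X Y Z : C} (hZ : P.IsTorsionFree Z) (f : X ⟶ Y)
    (hf : P (kernel f)) [Epi f] (g : X ⟶ Z) : ∃ h : Y ⟶ Z, f ≫ h = g :=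
  ⟨Abelian.epiDesc f g (hZ _ hf), Abelian.comp_epiDesc _ _ _⟩

section

variable [IsLocalizing P]

/-- The torsion functor is right adjoint to the inclusion. -/
noncomputable def torsionAdjunction : P.ι ⊣ torsionFunctor P := Adjunction.ofIsLeftAdjoint P.ι

/-- The torsion part of an object. -/
noncomputable abbrev torsion (X : C) : C := P.ι.obj ((torsionFunctor P).obj X)

/-- The inclusion of the torsion part. -/
noncomputable def torsionι (X : C) : torsion P X ⟶ X :=
  (torsionAdjunction P).counit.app X

/-- The quotient by the torsion part. -/
noncomputable abbrev torsionQuotient [Abelian C] (X : C) : C := cokernel (torsionι P X)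

lemma prop_torsion (X : C) : P (torsion P X) := ((torsionFunctor P).obj X).property

variable {P} in
lemma exists_comp_torsionι {T X : C} (hT : P T) (f : T ⟶ X) :
    ∃ g : T ⟶ torsion P X, g ≫ torsionι P X = f :=
  ⟨P.ι.map ((torsionAdjunction P).homEquiv ⟨T, hT⟩ X f),
    ((torsionAdjunction P).homEquiv_counit ⟨T, hT⟩ X _).symm.trans
      (Equiv.symm_apply_apply _ _)⟩

lemma torsionFunctor_map_comp_torsionι {X Y : C} (f : X ⟶ Y) :
    P.ι.map ((torsionFunctor P).map f) ≫ torsionι P Y = torsionι P X ≫ f :=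
  (torsionAdjunction P).counit.naturality f

variable [Abelian C] [P.IsSerreClass]

instance (X : C) : Mono (torsionι P X) := by
  refine Preadditive.mono_of_kernel_zero ?_
  have hK : P (kernel (torsionι P X)) := P.prop_of_mono (kernel.ι _) (prop_torsion P X)
  let k : (⟨_, hK⟩ : P.FullSubcategory) ⟶ (torsionFunctor P).obj X := P.homMk (kernel.ι _)
  -- Under the adjunction both k and 0 correspond to the zero map to X.
  have : k = 0 := by
    apply ((torsionAdjunction P).homEquiv _ _).symm.injective
    rw [Adjunction.homEquiv_counit, Adjunction.homEquiv_counit]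
    trans 0
    · exact kernel.condition (torsionι P X)
    · exact (zero_comp (f := torsionι P X)).symm
  exact congr_arg P.ι.map this

/-- The pullback of T ⟶ X/τX to X is an extension of T by a quotient of τX, so it lies in `P` and
its map to X lands in τX. -/
lemma isTorsionFree_torsionQuotient (X : C) : P.IsTorsionFree (torsionQuotient P X) := by
  intro T f hT
  let π := cokernel.π (torsionι P X)
  have sq := IsPullback.of_hasPullback π f
  have hK : P (kernel (pullback.snd π f)) := by
    have := isIso_kernel_map_of_isPullback sq.flip
    refine P.prop_of_iso (asIso (kernel.map _ _ _ _ sq.w.symm)).symm ?_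
    exact P.prop_of_epi (Abelian.factorThruImage (torsionι P X)) (prop_torsion P X)
  have hW : P (pullback π f) := (P.prop_X₂_of_exact
    (S := .mk _ _ (kernel.condition (pullback.snd π f))) (ShortComplex.exact_kernel _) hK hT :)
  obtain ⟨g, hg⟩ := exists_comp_torsionι hW (pullback.fst π f)
  rw [← cancel_epi (pullback.snd π f), ← pullback.condition, ← hg]
  simp [π]

/-- The torsion part of an injective object is a direct summand if `P` is closed under
essential monomorphisms. -/
lemma exists_torsionι_comp_eq_id [IsGrothendieckAbelian.{w} C]
    (hP : IsClosedUnderEssentialMonos P) (E : C) [Injective E] :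
    ∃ r : E ⟶ torsion P E, torsionι P E ≫ r = 𝟙 _ := by
  obtain ⟨Q, p, _, he⟩ := exists_epi_isEssentialMono (torsionι P E)
  have hQ : P Q := hP _ he (prop_torsion P E)
  have := he.mono
  -- Q is an essential extension of τE, hence torsion, so this extension of τE ⟶ E to Q lands in τE
  -- and provides the retraction.
  let g : Q ⟶ E := Injective.factorThru (torsionι P E) (torsionι P E ≫ p)
  have hg : (torsionι P E ≫ p) ≫ g = torsionι P E := Injective.comp_factorThru _ _
  obtain ⟨r, hr⟩ := exists_comp_torsionι hQ g
  refine ⟨p ≫ r, ?_⟩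
  rw [← cancel_mono (torsionι P E), Category.id_comp, Category.assoc, Category.assoc, hr,
    ← Category.assoc, hg]

lemma injective_torsionQuotient [IsGrothendieckAbelian.{w} C]
    (hP : IsClosedUnderEssentialMonos P) (E : C) [Injective E] :
    Injective (torsionQuotient P E) := by
  obtain ⟨r, hr⟩ := exists_torsionι_comp_eq_id P hP E
  let s : torsionQuotient P E ⟶ E := cokernel.desc _ (𝟙 E - r ≫ torsionι P E)
    (by simp [reassoc_of% hr])
  have hs : s ≫ cokernel.π (torsionι P E) = 𝟙 _ := by
    rw [← cancel_epi (cokernel.π _)]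
    simp [s]
  exact Retract.injective (Y := E) ⟨s, cokernel.π _, hs⟩

end

end Torsion

end CategoryTheory

namespace CategoryTheory

/-! ### Local objects and the right adjoint of a localization. -/

section Reflection

variable {C : Type*} [Category* C] {D : Type*} [Category* D] (L : C ⥤ D)
  (W : MorphismProperty C) [L.IsLocalization W] [W.HasRightCalculusOfFractions]

/-- A map L X ⟶ L Z is a right fraction X ← Y → Z, and locality of Z extends its numerator uniquely
along the denominator. -/
lemma MorphismProperty.isLocal.map_bijective {Z : C} (hZ : W.isLocal Z) (X : C) :
    Function.Bijective (fun f : X ⟶ Z ↦ L.map f) := by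
  refine ⟨fun f g h ↦ ?_, fun φ ↦ ?_⟩
  · obtain ⟨Y, s, hs, eq⟩ := (MorphismProperty.map_eq_iff_precomp L W f g).1 h
    exact (hZ s hs).1 eq
  · obtain ⟨ψ, hψ⟩ := Localization.exists_rightFraction L W φ
    obtain ⟨g, hg⟩ := (hZ ψ.s ψ.hs).2 ψ.f
    have := Localization.inverts L W ψ.s ψ.hs
    refine ⟨g, ?_⟩
    rw [hψ, ← cancel_epi (L.map ψ.s), MorphismProperty.RightFraction.map_s_comp_map, ← hg,
      L.map_comp]

/-- If every object has a reflection in the local objects which is inverted by the localization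
functor, then the localization functor has a fully faithful right adjoint. -/
lemma Localization.exists_rightAdjoint_of_isLocal
    (h : ∀ X : C, ∃ (Z : C) (s : X ⟶ Z), W s ∧ W.isLocal Z) :
    ∃ (G : D ⥤ C) (_ : L ⊣ G), G.Full ∧ G.Faithful ∧ ∀ Y, W.isLocal (G.obj Y) := by
  have := Localization.essSurj L W
  have h' (Y : D) : ∃ Z : C, W.isLocal Z ∧ Nonempty (L.obj Z ≅ Y) := by
    obtain ⟨Z, s, hs, hZ⟩ := h (L.objPreimage Y)
    have := Localization.inverts L W s hs
    exact ⟨Z, hZ, ⟨(asIso (L.map s)).symm ≪≫ L.objObjPreimageIso Y⟩⟩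
  choose G hG e using h'
  let e (Y : D) := (e Y).some
  let E (X : C) (Y : D) : (L.obj X ⟶ Y) ≃ (X ⟶ G Y) :=
    ((Equiv.ofBijective _ ((hG Y).map_bijective L W X)).trans (e Y).homToEquiv).symm
  have hE (X' X : C) (Y : D) (f : X' ⟶ X) (g : L.obj X ⟶ Y) :
      E X' Y (L.map f ≫ g) = f ≫ E X Y g := by
    obtain ⟨g, rfl⟩ := (E X Y).symm.surjective g
    rw [Equiv.apply_symm_apply, ← Equiv.eq_symm_apply]
    simp [E]
  let adj := Adjunction.adjunctionOfEquivRight E hE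
  have (Y : D) : IsIso (adj.counit.app Y) := by
    have : adj.counit.app Y = (e Y).hom := by
      simp [adj, Adjunction.adjunctionOfEquivRight, E, Adjunction.rightAdjointOfEquiv]
    rw [this]
    infer_instance
  have : IsIso adj.counit := NatIso.isIso_of_isIso_app _
  exact ⟨_, adj, adj.fullyFaithfulROfIsIsoCounit.full, adj.fullyFaithfulROfIsIsoCounit.faithful, hG⟩

end Reflection

/-! ### Local objects for a Serre class; localization preserves injectives. -/

section Local

open ZeroObject

variable {C : Type u} [Category.{v} C] [Abelian C] (P : ObjectProperty C) [P.IsSerreClass]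

/-- Factor f as an epi with torsion kernel and a mono with torsion cokernel. Torsion-freeness of
`S.X₁` handles the epi. Along the mono, extend into the injective `S.X₂`; the composite to `S.X₃`
factors through the torsion cokernel, so it is zero. -/
lemma isLocal_of_shortExact {S : ShortComplex C} (hS : S.ShortExact) [Injective S.X₂]
    (h₁ : P.IsTorsionFree S.X₁) (h₃ : P.IsTorsionFree S.X₃) : P.isoModSerre.isLocal S.X₁ := by
  intro X Y f hf
  refine ⟨fun a b hab ↦ ?_, fun g ↦ ?_⟩
  · dsimp at hab
    rw [← sub_eq_zero, ← Preadditive.comp_sub] at hab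
    rw [← sub_eq_zero, ← cokernel.π_desc f _ hab, h₁ (cokernel.desc f _ hab) hf.2, comp_zero]
  · obtain ⟨h, hh⟩ := h₁.factors (Abelian.factorThruImage f)
      (ObjectProperty.monoModSerre.isoModSerre_factorThruImage hf.1).1 g
    let k : Y ⟶ S.X₂ := Injective.factorThru (h ≫ S.f) (Abelian.image.ι f)
    have hk : Abelian.image.ι f ≫ k = h ≫ S.f := Injective.comp_factorThru _ _
    have hk' : Abelian.image.ι f ≫ k ≫ S.g = 0 := by simp [reassoc_of% hk]
    have hk₀ : k ≫ S.g = 0 := by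
      rw [← cokernel.π_desc _ _ hk', h₃ (cokernel.desc _ _ hk')
        (ObjectProperty.epiModSerre.isoModSerre_image_ι hf.2).2, comp_zero]
    have := hS.mono_f
    refine ⟨hS.exact.lift k hk₀, ?_⟩
    rw [← cancel_mono S.f]
    dsimp
    rw [Category.assoc, hS.exact.lift_f, ← hh, Category.assoc, ← hk,
      ← Category.assoc, Abelian.image.fac]

lemma isLocal_of_injective {E : C} [Injective E] (hE : P.IsTorsionFree E) :
    P.isoModSerre.isLocal E := by
  have hS : (ShortComplex.mk (𝟙 E) (0 : E ⟶ 0) comp_zero).ShortExact :=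
    (ShortComplex.Splitting.ofIsIsoOfIsZero _ inferInstance (isZero_zero C)).shortExact
  exact isLocal_of_shortExact P hS hE fun T f _ ↦ (isZero_zero C).eq_of_tgt _ _

variable [IsLocalizing P]

lemma isoModSerre_torsionQuotient_π (X : C) :
    P.isoModSerre (cokernel.π (torsionι P X)) := by
  rw [ObjectProperty.isoModSerre_iff_of_epi]
  exact P.prop_of_epi (Abelian.factorThruImage (torsionι P X)) (prop_torsion P X)

/-- Embed Y in an injective E and pass to E/τE: the kernel on Y embeds in τE, so it is torsion and
vanishes. -/
lemma exists_mono_injective_isTorsionFree [IsGrothendieckAbelian.{w} C]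
    (hP : IsClosedUnderEssentialMonos P) {Y : C} (hY : P.IsTorsionFree Y) :
    ∃ (E : C) (j : Y ⟶ E), Mono j ∧ Injective E ∧ P.IsTorsionFree E := by
  refine ⟨torsionQuotient P (Injective.under Y), Injective.ι Y ≫ cokernel.π _, ?_,
    injective_torsionQuotient P hP _, isTorsionFree_torsionQuotient P _⟩
  refine Preadditive.mono_of_kernel_zero (hY _ ?_)
  let j := Injective.ι Y ≫ cokernel.π (torsionι P (Injective.under Y))
  let k : kernel j ⟶ torsion P (Injective.under Y) :=
    Abelian.monoLift (torsionι P _) (kernel.ι j ≫ Injective.ι Y)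
      (by rw [Category.assoc]; exact kernel.condition j)
  have hk : k ≫ torsionι P _ = kernel.ι j ≫ Injective.ι Y := Abelian.monoLift_comp _ _ _
  have : Mono k := by
    have : Mono (k ≫ torsionι P _) := by rw [hk]; infer_instance
    exact mono_of_mono k (torsionι P _)
  exact P.prop_of_mono k (prop_torsion P _)

lemma exists_isoModSerre_isLocal [IsGrothendieckAbelian.{w} C]
    (hP : IsClosedUnderEssentialMonos P) (X : C) :
    ∃ (Z : C) (s : X ⟶ Z), P.isoModSerre s ∧ P.isoModSerre.isLocal Z := by
  have hY := isTorsionFree_torsionQuotient P X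
  obtain ⟨E, j, _, _, hE⟩ := exists_mono_injective_isTorsionFree P hP hY
  -- With Y = X/τX embedded in E, the reflection is the preimage in E of the torsion part of E/Y,
  -- that is, the kernel of q.
  let q : E ⟶ torsionQuotient P (cokernel j) := cokernel.π j ≫ cokernel.π _
  have hS : (ShortComplex.mk _ _ (kernel.condition q)).ShortExact :=
    { exact := ShortComplex.exact_kernel q
      epi_g := by dsimp [q]; infer_instance }
  have hloc : P.isoModSerre.isLocal (kernel q) :=
    isLocal_of_shortExact P hS (hE.of_mono (kernel.ι q)) (isTorsionFree_torsionQuotient P _)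
  let t : torsionQuotient P X ⟶ kernel q := kernel.lift q j (by simp [q])
  have ht : t ≫ kernel.ι q = j := kernel.lift_ι _ _ _
  have : Mono t := mono_of_mono_fac ht
  let r : kernel q ⟶ torsion P (cokernel j) :=
    Abelian.monoLift (torsionι P _) (kernel.ι q ≫ cokernel.π j)
      (by rw [Category.assoc]; exact kernel.condition q)
  have hr : r ≫ torsionι P _ = kernel.ι q ≫ cokernel.π j := Abelian.monoLift_comp _ _ _
  have htr : t ≫ r = 0 := by
    rw [← cancel_mono (torsionι P _), Category.assoc, hr, reassoc_of% ht, cokernel.condition,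
      zero_comp]
  have hex : (ShortComplex.mk t r htr).Exact := by
    refine ShortComplex.exact_of_f_is_kernel _ (KernelFork.IsLimit.ofι' _ _ fun {A} x hx ↦ ?_)
    have hx' : (x ≫ kernel.ι q) ≫ cokernel.π j = 0 := by
      rw [Category.assoc, ← hr, reassoc_of% hx, zero_comp]
    refine ⟨Abelian.monoLift j _ hx', ?_⟩
    rw [← cancel_mono (kernel.ι q), Category.assoc, ht, Abelian.monoLift_comp]
  have hc : P (cokernel t) := by
    have : Mono (cokernel.desc t r htr) := hex.mono_cokernelDesc
    exact P.prop_of_mono (cokernel.desc t r htr) (prop_torsion P _)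
  exact ⟨_, cokernel.π _ ≫ t, P.isoModSerre.comp_mem _ _ (isoModSerre_torsionQuotient_π P X)
    (P.isoModSerre_of_mono _ hc), hloc⟩

variable {D : Type*} [Category* D] (L : C ⥤ D) [L.IsLocalization P.isoModSerre]

/-- Replace E by the local injective E/τE. Maps from L(GX) to its image come from maps out of GX,
and these extend along G i, a mono. -/
lemma injective_localization_obj [IsGrothendieckAbelian.{w} C]
    (hP : IsClosedUnderEssentialMonos P) (E : C) [Injective E] : Injective (L.obj E) := by
  have := Localization.inverts L P.isoModSerre _ (isoModSerre_torsionQuotient_π P E)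
  refine Injective.of_iso (asIso (L.map (cokernel.π (torsionι P E)))).symm ?_
  have := injective_torsionQuotient P hP E
  have hloc := isLocal_of_injective P (isTorsionFree_torsionQuotient P E)
  obtain ⟨G, adj, _, _, hG⟩ := Localization.exists_rightAdjoint_of_isLocal L P.isoModSerre
    (exists_isoModSerre_isLocal P hP)
  refine ⟨fun {X Y} φ i _ ↦ ?_⟩
  have : G.PreservesMonomorphisms := G.preservesMonomorphisms_of_adjunction adj
  obtain ⟨g, hg⟩ := (hloc.map_bijective L P.isoModSerre _).2 (adj.counit.app X ≫ φ)
  dsimp at hg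
  refine ⟨inv (adj.counit.app Y) ≫ L.map (Injective.factorThru g (G.map i)), ?_⟩
  have h := adj.counit.naturality i
  dsimp at h
  rw [← cancel_epi (adj.counit.app X), ← reassoc_of% h, IsIso.hom_inv_id_assoc, ← L.map_comp,
    Injective.comp_factorThru, hg]

end Local

end CategoryTheory

namespace CategoryTheory

open Abelian

/-! ### Dividing exact sequences and injective resolutions by torsion. -/

section

variable {C : Type u} [Category.{v} C] [Abelian C] (P : ObjectProperty C) [P.IsSerreClass]
  [IsLocalizing P]

/-- The map induced on quotients by the torsion parts. -/
noncomputable def torsionQuotientMap {X Y : C} (f : X ⟶ Y) :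
    torsionQuotient P X ⟶ torsionQuotient P Y :=
  cokernel.map _ _ (P.ι.map ((torsionFunctor P).map f)) f
    (torsionFunctor_map_comp_torsionι P f).symm

omit [P.IsSerreClass] in
@[simp]
lemma π_torsionQuotientMap {X Y : C} (f : X ⟶ Y) :
    cokernel.π (torsionι P X) ≫ torsionQuotientMap P f = f ≫ cokernel.π (torsionι P Y) :=
  cokernel.π_desc _ _ _

/-- The short complex obtained by dividing out the torsion parts. -/
noncomputable abbrev torsionQuotientShortComplex (S : ShortComplex C) : ShortComplex C :=
  ShortComplex.mk (torsionQuotientMap P S.f) (torsionQuotientMap P S.g) (by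
    rw [← cancel_epi (cokernel.π _), ← Category.assoc, π_torsionQuotientMap, Category.assoc,
      π_torsionQuotientMap, ← Category.assoc, S.zero, zero_comp, comp_zero])

lemma exists_comp_torsionι_of_comp_π_eq_zero {A X : C} (x : A ⟶ X)
    (hx : x ≫ cokernel.π (torsionι P X) = 0) : ∃ y : A ⟶ torsion P X, y ≫ torsionι P X = x :=
  ⟨Abelian.monoLift _ x hx, Abelian.monoLift_comp _ _ _⟩

/-- The preimage of τY under f embeds in τY, so it is torsion and lies in τX. -/
instance mono_torsionQuotientMap {X Y : C} (f : X ⟶ Y) [Mono f] :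
    Mono (torsionQuotientMap P f) := by
  refine Preadditive.mono_of_cancel_zero _ fun {A} x hx ↦ ?_
  obtain ⟨A', π, _, x', hx'⟩ := surjective_up_to_refinements_of_epi
    (cokernel.π (torsionι P X)) x
  obtain ⟨y, hy⟩ := exists_comp_torsionι_of_comp_π_eq_zero P (x' ≫ f) (by
    rw [Category.assoc, ← π_torsionQuotientMap, ← reassoc_of% hx', hx, comp_zero])
  obtain ⟨z, hz⟩ := exists_comp_torsionι
    (P.prop_of_mono (pullback.fst (torsionι P Y) f) (prop_torsion P Y))
    (pullback.snd (torsionι P Y) f)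
  have : x' = pullback.lift y x' hy ≫ z ≫ torsionι P X := by
    rw [hz, pullback.lift_snd]
  rw [← cancel_epi π, hx', this]
  simp

/-- Dividing out the torsion parts of a short exact sequence yields a short exact sequence,
provided that the torsion functor preserves its exactness. -/
lemma ShortComplex.ShortExact.torsionQuotient {S : ShortComplex C} (hS : S.ShortExact)
    (h : Epi ((torsionFunctor P).map S.g)) : (torsionQuotientShortComplex P S).ShortExact := by
  have := hS.mono_f
  have := hS.epi_g
  have : Epi (P.ι.map ((torsionFunctor P).map S.g)) := by
    have := P.ι.preservesEpimorphisms_of_adjunction (torsionAdjunction P)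
    infer_instance
  have hg : Epi (torsionQuotientMap P S.g) := by
    have : Epi (cokernel.π (torsionι P S.X₂) ≫ torsionQuotientMap P S.g) := by
      rw [π_torsionQuotientMap]; infer_instance
    exact epi_of_epi (cokernel.π (torsionι P S.X₂)) _
  have hf : Mono (torsionQuotientMap P S.f) := inferInstance
  refine ShortComplex.ShortExact.mk ?_
  rw [ShortComplex.exact_iff_exact_up_to_refinements]
  intro A x hx
  dsimp at x hx
  obtain ⟨A₁, π₁, _, x₁, hx₁⟩ := surjective_up_to_refinements_of_epi
    (cokernel.π (torsionι P S.X₂)) x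
  obtain ⟨y, hy⟩ := exists_comp_torsionι_of_comp_π_eq_zero P (x₁ ≫ S.g) (by
    rw [Category.assoc, ← π_torsionQuotientMap, ← reassoc_of% hx₁, hx, comp_zero])
  obtain ⟨A₂, π₂, _, y₂, hy₂⟩ := surjective_up_to_refinements_of_epi
    (P.ι.map ((torsionFunctor P).map S.g)) y
  -- The image of x₁ in `S.X₃` is torsion; surjectivity on torsion parts lifts it to τ of `S.X₂`,
  -- and subtracting this lift puts x₁ in the kernel of `S.g`.
  obtain ⟨A₃, π₃, _, x₃, hx₃⟩ := hS.exact.exact_up_to_refinements (π₂ ≫ x₁ - y₂ ≫ torsionι P _)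
    (by rw [Preadditive.sub_comp, Category.assoc, ← hy, reassoc_of% hy₂, Category.assoc,
      torsionFunctor_map_comp_torsionι, sub_self])
  refine ⟨A₃, π₃ ≫ π₂ ≫ π₁, inferInstance, x₃ ≫ cokernel.π _, ?_⟩
  dsimp
  rw [Category.assoc x₃, π_torsionQuotientMap, ← reassoc_of% hx₃]
  simp [hx₁]

variable [HasInjectiveResolutions C]

omit [HasInjectiveResolutions C] in
lemma ShortComplex.Exact.epi_of_comp_eq_f {S : ShortComplex C} (hS : S.Exact) {Z : C}
    (p : S.X₁ ⟶ Z) (i : Z ⟶ S.X₂) [Mono i] (hp : p ≫ i = S.f) (hi : i ≫ S.g = 0) : Epi p := by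
  obtain ⟨A, π, _, x, hx⟩ := hS.exact_up_to_refinements i hi
  have : π = x ≫ p := by rw [← cancel_mono i, hx, Category.assoc, hp]
  have : Epi (x ≫ p) := by rw [← this]; infer_instance
  exact epi_of_epi x p

omit [HasInjectiveResolutions C] in
open HomologicalComplex in
lemma InjectiveResolution.shortExact_cycles {X : C} (I : InjectiveResolution X) (n : ℕ) :
    (ShortComplex.mk (I.cocomplex.iCycles n) (I.cocomplex.toCycles n (n + 1)) (by
      rw [← cancel_mono (I.cocomplex.iCycles _)]; simp)).ShortExact := by
  have : Epi (I.cocomplex.toCycles n (n + 1)) :=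
    (I.exact_succ n).epi_of_comp_eq_f _ (I.cocomplex.iCycles (n + 1)) (toCycles_i _ _ _)
      (iCycles_d _ _ _)
  refine ShortComplex.ShortExact.mk (ShortComplex.exact_of_f_is_kernel _ ?_)
  refine KernelFork.IsLimit.ofι' _ _ fun {A} x hx ↦ ?_
  have hx' : x ≫ I.cocomplex.d n (n + 1) = 0 := by
    have h : x ≫ I.cocomplex.toCycles n (n + 1) = 0 := hx
    exact (congr_arg (x ≫ ·) (toCycles_i _ _ _)).symm.trans (by
      dsimp only; rw [reassoc_of% h, zero_comp])
  exact ⟨I.cocomplex.liftCycles x (n + 1) (by simp) hx', I.cocomplex.liftCycles_i _ _ _ _⟩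

/-- Vanishing of the derived functor makes τI exact in degree n + 1. As τ preserves monos, τZⁿ⁺¹ is
a subobject of τIⁿ⁺¹ killed by the differential, so τIⁿ maps onto it. -/
lemma InjectiveResolution.epi_torsionFunctor_map_toCycles {X : C} (I : InjectiveResolution X)
    (n : ℕ) (h : IsZero (((torsionFunctor P).rightDerived (n + 1)).obj X)) :
    Epi ((torsionFunctor P).map (I.cocomplex.toCycles n (n + 1))) := by
  let T := torsionFunctor P
  have : Mono (T.map (I.cocomplex.iCycles (n + 1))) := by
    have := T.preservesMonomorphisms_of_adjunction (torsionAdjunction P)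
    infer_instance
  have h₁ : ((T.mapHomologicalComplex _).obj I.cocomplex).ExactAt (n + 1) := by
    rw [HomologicalComplex.exactAt_iff_isZero_homology]
    exact h.of_iso (I.isoRightDerivedObj T (n + 1)).symm
  rw [HomologicalComplex.exactAt_iff' _ n (n + 1) (n + 2) (by simp)
    (by simp only [CochainComplex.next]; rfl)] at h₁
  have h₂ : (ShortComplex.mk (T.map (I.cocomplex.d n (n + 1))) (T.map (I.cocomplex.d _ (n + 2)))
    (by rw [← T.map_comp, HomologicalComplex.d_comp_d, T.map_zero])).Exact := h₁
  refine h₂.epi_of_comp_eq_f _ (T.map (I.cocomplex.iCycles (n + 1))) ?_ ?_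
  · exact (T.map_comp _ _).symm.trans (congr_arg _ (HomologicalComplex.toCycles_i _ _ _))
  · exact (T.map_comp _ _).symm.trans
      ((congr_arg _ (HomologicalComplex.iCycles_d _ _ _)).trans (T.map_zero _ _))

end

/-! ### Ext and projective dimension in the localization. -/

section

variable {C : Type u} [Category.{v} C] [Abelian C] (P : ObjectProperty C) [P.IsSerreClass]
  [IsLocalizing P] {D : Type*} [Category* D] [Abelian D] (L : C ⥤ D)
  [L.IsLocalization P.isoModSerre] [L.Additive]

/-- Let `Q` be a class of objects each of which embeds in a torsion-free injective object with
cokernel in `Q`. Then the vanishing of `Ext X Z (k + 1)` for `Z` in `Q` is inherited by the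
localization. -/
lemma subsingleton_ext_localization [IsGrothendieckAbelian.{w} C]
    (hP : IsClosedUnderEssentialMonos P) [HasExt C] [HasExt D] (Q : ObjectProperty C)
    (hQ : ∀ Z, Q Z → ∃ S : ShortComplex C, S.ShortExact ∧ Injective S.X₂ ∧
      P.IsTorsionFree S.X₂ ∧ S.X₁ = Z ∧ Q S.X₃) (X : C) (k : ℕ) :
    ∀ Z : C, Q Z → Subsingleton (Ext X Z (k + 1)) →
      Subsingleton (Ext (L.obj X) (L.obj Z) (k + 1)) := by
  have := ObjectProperty.SerreClassLocalization.preservesFiniteLimits L P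
  have := ObjectProperty.SerreClassLocalization.preservesFiniteColimits L P
  induction k with
  | zero =>
    intro Z hZ h
    obtain ⟨S, hS, _, hS₂, rfl, hS₃⟩ := hQ Z hZ
    obtain ⟨S', hS', _, hS₂', h', hS₃'⟩ := hQ _ hS₃
    -- Two further steps of the coresolution present `S.X₃` as the kernel of a map from a
    -- torsion-free injective onto a torsion-free object. Then maps L X ⟶ L `S.X₃` come from C,
    -- where they lift.
    have hloc : P.isoModSerre.isLocal S.X₃ := by
      rw [← h']
      have := hS'.mono_f
      have := hS'.epi_g
      obtain ⟨S'', hS'', _, hS₂'', h'', _⟩ := hQ _ hS₃'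
      refine isLocal_of_shortExact P hS' (hS₂'.of_mono S'.f) ?_
      rw [← h'']
      have := hS''.mono_f
      exact hS₂''.of_mono S''.f
    have hLS := hS.map_of_exact L
    have hI : Injective (S.map L).X₂ := injective_localization_obj P L hP S.X₂
    rw [zero_add, hS.subsingleton_ext_one_iff ‹_›] at h
    refine (hLS.subsingleton_ext_one_iff hI (L.obj X)).2 fun f ↦ ?_
    obtain ⟨f, rfl⟩ := (hloc.map_bijective L P.isoModSerre X).2 f
    obtain ⟨g, rfl⟩ := h f
    exact ⟨L.map g, (L.map_comp _ _).symm⟩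
  | succ k hk =>
    intro Z hZ h
    obtain ⟨S, hS, _, hS₂, rfl, hS₃⟩ := hQ Z hZ
    have hLS := hS.map_of_exact L
    have hI : Injective (S.map L).X₂ := injective_localization_obj P L hP S.X₂
    exact (hLS.subsingleton_ext_succ_iff hI (L.obj X) k).2
      (hk _ hS₃ ((hS.subsingleton_ext_succ_iff ‹_› X k).1 h))

/-- In the bound `m + 1 + d`, the comparison of Ext needs a positive degree, hence `m + 1`, and d
dimension shifts lead from the d-th cosyzygy back to Y. -/
lemma exists_hasProjectiveDimensionLT_localization_obj [IsGrothendieckAbelian.{w} C]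
    (hP : IsClosedUnderEssentialMonos P) (hτ : HasFiniteCohomologicalDimension (torsionFunctor P))
    [EnoughInjectives D] :
    ∃ d : ℕ, ∀ (X : C) (m : ℕ), HasProjectiveDimensionLT X m →
      HasProjectiveDimensionLT (L.obj X) (m + 1 + d) := by
  have := ObjectProperty.SerreClassLocalization.preservesFiniteLimits L P
  have := ObjectProperty.SerreClassLocalization.preservesFiniteColimits L P
  have := Localization.essSurj L P.isoModSerre
  let := HasExt.standard C
  let := HasExt.standard D
  obtain ⟨d, hd⟩ := hτ
  refine ⟨d, fun X m hX ↦ hasProjectiveDimensionLT_of_enoughInjectives _ _ fun Y ↦ ?_⟩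
  obtain ⟨I⟩ := (inferInstance : HasInjectiveResolution (L.objPreimage Y)).out
  let K := I.cocomplex
  have e₀ : K.cycles 0 ≅ L.objPreimage Y :=
    (K.cyclesIsKernel 0 1 (by simp)).conePointUniqueUpToIso I.isLimitKernelFork
  have shift (j : ℕ) : ∀ k : ℕ, Subsingleton (Ext (L.obj X) (L.obj (K.cycles j)) (k + 1)) →
      Subsingleton (Ext (L.obj X) (L.obj (K.cycles 0)) (k + 1 + j)) := by
    induction j with
    | zero => exact fun k h ↦ h
    | succ j hj =>
      intro k h
      have hS := (I.shortExact_cycles j).map_of_exact L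
      have hI : Injective (L.obj (I.cocomplex.X j)) := injective_localization_obj P L hP _
      have := hj (k + 1) ((hS.subsingleton_ext_succ_iff hI (L.obj X) k).2 h)
      rwa [show k + 1 + (j + 1) = k + 1 + 1 + j by lia]
  -- From degree d on, τ preserves exactness of the cosyzygy sequences, so these torsion-free
  -- quotients embed in torsion-free injectives with cokernel of the same kind. L does not see the
  -- torsion divided out.
  let Q : ObjectProperty C := fun Z ↦ ∃ n, d ≤ n ∧ torsionQuotient P (K.cycles n) = Z
  have hext : Subsingleton (Ext (L.obj X) (L.obj (torsionQuotient P (K.cycles d))) (m + 1)) := by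
    refine subsingleton_ext_localization P L hP Q ?_ X m _ ⟨d, le_rfl, rfl⟩
      (HasProjectiveDimensionLT.subsingleton X m _ m.le_succ _)
    rintro _ ⟨n, hn, rfl⟩
    have hS := (I.shortExact_cycles n).torsionQuotient P
      (I.epi_torsionFunctor_map_toCycles P n ((hd (n + 1) (by lia)).obj _))
    exact ⟨_, hS, injective_torsionQuotient P hP _, isTorsionFree_torsionQuotient P _, rfl,
      n + 1, by lia, rfl⟩
  have := Localization.inverts L P.isoModSerre _ (isoModSerre_torsionQuotient_π P (K.cycles d))
  refine Ext.subsingleton_of_iso (Iso.refl _) (L.mapIso e₀ ≪≫ L.objObjPreimageIso Y)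
    (shift d m (Ext.subsingleton_of_iso (Iso.refl _)
      (asIso (L.map (cokernel.π (torsionι P (K.cycles d))))).symm hext))

end

end CategoryTheory

namespace CategoryTheory

/-! ### The Gorenstein axioms for the localization. -/

section

variable {C : Type u} [Category.{v} C] [Abelian C]

omit [Abelian C] in
lemma IsSeparator.exists_epi_copower [HasCoproducts.{w} C] [LocallySmall.{w} C] {T : C}
    (hT : IsSeparator T) (X : C) :
    ∃ (ι : Type w) (p : (∐ fun _ : ι ↦ T) ⟶ X), Epi p := by
  refine ⟨Shrink.{w} (T ⟶ X), Limits.Sigma.desc fun i ↦ (equivShrink _).symm i, ⟨fun f g h ↦ ?_⟩⟩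
  refine hT.def _ _ fun t ↦ ?_
  simpa using Limits.Sigma.ι (fun _ : Shrink.{w} (T ⟶ X) ↦ T) (equivShrink _ t) ≫= h

variable (P : ObjectProperty C) [P.IsSerreClass] [IsLocalizing P]

/-- The localization of a Gorenstein Grothendieck category at a Serre class closed under
essential monomorphisms whose torsion functor has finite cohomological dimension. -/
theorem isGorensteinCategory_localization [IsGrothendieckAbelian.{w} C]
    (hP : IsClosedUnderEssentialMonos P) (hC : IsGorensteinCategory.{w} C)
    (hτ : HasFiniteCohomologicalDimension (torsionFunctor P))
    {D : Type*} [Category* D] [Abelian D] (L : C ⥤ D) [L.IsLocalization P.isoModSerre]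
    [L.Additive] : IsGorensteinCategory.{w} D := by
  have := ObjectProperty.SerreClassLocalization.preservesFiniteLimits L P
  have := ObjectProperty.SerreClassLocalization.preservesFiniteColimits L P
  obtain ⟨G, adj, _, _, -⟩ := Localization.exists_rightAdjoint_of_isLocal L P.isoModSerre
    (exists_isoModSerre_isLocal P hP)
  have e (Y : D) : L.obj (G.obj Y) ≅ Y := asIso (adj.counit.app Y)
  have : Reflective G := { L := L, adj := adj }
  have hcop : HasCoproducts.{w} D := fun ι ↦ hasColimitsOfShape_of_reflective G
  have hL (E : C) (_ : Injective E) : Injective (L.obj E) := injective_localization_obj P L hP E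
  have hinj : EnoughInjectives D := ⟨fun Y ↦ ⟨
    { J := L.obj (Injective.under (G.obj Y))
      injective := hL _ inferInstance
      f := (e Y).inv ≫ L.map (Injective.ι (G.obj Y)) }⟩⟩
  obtain ⟨d, hd⟩ := exists_hasProjectiveDimensionLT_localization_obj P L hP hτ
  obtain ⟨T, hT, hTpd⟩ := hC.exists_generator
  obtain ⟨b, hb⟩ := hC.bounded
  -- I ≅ L(GI) with GI injective in C, so the bound b for C is raised only by the cost of L.
  have hbound (I : D) (_ : Injective I) : HasProjectiveDimensionLT I (b + 1 + d + 1) := by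
    have : Injective (G.obj I) := Injective.injective_of_adjoint adj I
    have h := hd (G.obj I) (b + 1) ((projectiveDimension_le_iff _ _).1 (hb _ this))
    rw [show b + 1 + d + 1 = b + 1 + 1 + d by lia]
    exact hasProjectiveDimensionLT_of_iso (e I) _
  refine ⟨hcop, ⟨fun ι ↦ adj.hasExactColimitsOfShape _⟩, hinj, ⟨L.obj T, ?_, ?_⟩, fun X ↦ ⟨?_, ?_⟩,
    ⟨b + 1 + d, fun I hI ↦ (projectiveDimension_le_iff _ _).2 (hbound I hI)⟩⟩
  -- Maps L T ⟶ X are maps T ⟶ GX, T separates, and G is faithful.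
  · refine (isSeparator_def _).2 fun X Y f g h ↦ G.map_injective (hT.def _ _ fun t ↦ ?_)
    obtain ⟨t, rfl⟩ := (adj.homEquiv _ _).surjective t
    rw [← adj.homEquiv_naturality_right, ← adj.homEquiv_naturality_right, h]
  · obtain ⟨n, hn⟩ := projectiveDimension_lt_top_iff.1 hTpd
    exact projectiveDimension_lt_top_iff.2 ⟨_, hd T n hn⟩
  · intro hX
    obtain ⟨n, hn⟩ := projectiveDimension_lt_top_iff.1 hX
    have := hC.enoughInjectives
    obtain ⟨m, hm⟩ := exists_hasInjectiveDimensionLT_copower.{w}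
      (fun X ↦ (hC.finite_iff X).1) hTpd
    refine injectiveDimension_lt_top_iff.2
      ⟨m, hasInjectiveDimensionLT_of_hasProjectiveDimensionLT (fun Y ↦ ?_) X n⟩
    -- A copower of T covers GY; its image under L covers Y and keeps injective dimension `< m`,
    -- uniformly in Y.
    obtain ⟨ι, p, _⟩ := hT.exists_epi_copower (G.obj Y)
    exact ⟨_, L.map p ≫ (e Y).hom, inferInstance, L.hasInjectiveDimensionLT_obj hL _ _ (hm ι)⟩
  · intro hX
    obtain ⟨n, hn⟩ := injectiveDimension_lt_top_iff.1 hX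
    exact projectiveDimension_lt_top_iff.2
      ⟨_, hasProjectiveDimensionLT_of_hasInjectiveDimensionLT hbound n X hn⟩

end

end CategoryTheory

theorem corollary4p4 {A : Type u} [Category.{v} A] [Abelian A] [IsGrothendieckAbelian.{w} A]
    (B : ObjectProperty A) [B.IsSerreClass] [IsLocalizing B]
    (hB : IsClosedUnderEssentialMonos B)
    (hA : IsGorensteinCategory.{w} A)
    (hτ : HasFiniteCohomologicalDimension (torsionFunctor B)) :
    IsGorensteinCategory.{w} (SerreQuotient B) := by
  exact CategoryTheory.isGorensteinCategory_localization B hB hA hτ B.isoModSerre.Q
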